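/- Let $q$ be a power of a prime $p$, let $n\ge 1$, and consider $\mathbb{F}_{q^n}$ over $\mathbb{F}_q$. An element $\alpha\in\mathbb{F}_{q^n}$ is primitive if it generates the multiplicative group $\mathbb{F}_{q^n}^{*}$. For $0\le k\le n-1$, it is $k$-normal over $\mathbb{F}_q$ if $$\deg\gcd\Big(x^n-1,\ \sum_{i=0}^{n-1}\alpha^{q^i}x^{n-1-i}\Big)=k .$$ (1) Let $n$ be a prime different from $p$ such that $q$ is primitive modulo $n$ (that is, $q$ generates $(\mathbb{Z}/n\mathbb{Z})^{*}$). (a) If $\mathbb{F}_{q^n}$ contains a primitive $1$-normal element over $\mathbb{F}_q$, then $n\ge 3$ or $(n,q)=(2,3)$. (This is a necessary condition only; existence for $(n,q)=(2,3)$ is not asserted.) (b) If $n\ge 3$ and $(n,q)\ne(3,4)$, then $\mathbb{F}_{q^n}$ contains a primitive $1$-normal element over $\mathbb{F}_q$. (2) Consequently, for every odd prime power $q\ne 3$, the field $\mathbb{F}_{q^2}$ contains no primitive $1$-normal element over $\mathbb{F}_q$. In particular, it is not true that for all prime powers $q$ and all $n\ge 2$ there is a primitive $1$-normal element of $\mathbb{F}_{q^n}$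 over $\mathbb{F}_q$. -/

import Mathlib

open Polynomial

/-- `a` is a primitive element of the monoid `M`: it is a unit and it generates the group of
units of `M`.  For a finite field `K` this is a generator of the cyclic group `Kˣ`; for
`M = ZMod n` this is a primitive element (primitive root) modulo `n`. -/
def IsPrimitiveElt {M : Type*} [Monoid M] (a : M) : Prop :=
  ∃ u : Mˣ, (u : M) = a ∧ ∀ v : Mˣ, v ∈ Subgroup.zpowers u

/-- The polynomial `∑_{i=0}^{n-1} α^{q^i} x^{n-1-i}` over `K`, where `q = |F|` and `n = [K : F]`. -/
noncomputable def conjugatePoly (F : Type*) {K : Type*} [Field F] [Field K] [Algebra F K]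
    (α : K) : K[X] :=
  ∑ i ∈ Finset.range (Module.finrank F K),
    C (α ^ Nat.card F ^ i) * X ^ (Module.finrank F K - 1 - i)

open Classical in
/-- For `0 ≤ k ≤ n - 1`, where `n = [K : F]`, the element `α` of `K` is `k`-normal over the finite
field `F` if `gcd (x^n - 1, ∑_{i=0}^{n-1} α^{q^i} x^{n-1-i})` has degree `k`. -/
def IsKNormal (F : Type*) {K : Type*} [Field F] [Field K] [Algebra F K] (k : ℕ) (α : K) : Prop :=
  k < Module.finrank F K ∧
    (EuclideanDomain.gcd (X ^ Module.finrank F K - 1 : K[X]) (conjugatePoly F α)).natDegree = k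

/-- `K` contains a primitive 1-normal element over `F`. -/
def HasPrimitiveOneNormal (F K : Type*) [Field F] [Field K] [Algebra F K] : Prop :=
  ∃ α : K, IsPrimitiveElt α ∧ IsKNormal F 1 α

/-! Write `q = |F|`, `n = [K : F]` and `Q = (q ^ n - 1) / (q - 1)`.

For `n = 2`, `1`-normality of `α` gives a common root `x` of `X ^ 2 - 1` and `α * X + α ^ q`, so
`α ^ (q - 1) = -x` and `α ^ (2 * (q - 1)) = 1`, which is impossible for an element of order
`q ^ 2 - 1`. Hence no quadratic extension has a primitive `1`-normal element
(`not_hasPrimitiveOneNormal_of_finrank_eq_two`), which settles every nonexistence claim.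

For a prime `n ≥ 3` such that `q` is primitive modulo `n`, every nonzero `α` of trace zero is
`1`-normal (`isKNormal_one_of_trace_eq_zero`): the roots of `conjugatePoly F α` among the `n`-th
roots of unity are stable under `z ↦ z ^ q`, and `1` is one of them, so a second one would produce
all `n` of them, more than the degree allows. It remains to find a primitive element of trace zero
(`exists_isPrimitiveElt_trace_eq_zero`).

Multiplication by `F` preserves trace zero, so it is enough to find an element of trace zero that is
not an `l`-th power for any prime `l ∣ Q`. The elements of trace zero form a relative difference
set (Singer): the number of pairs of them with a given quotient `h` depends only on whether `h ∈ F`,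
because `Tr x` and `Tr (x * h)` are independent linear forms when `h ∉ F`. A second moment
computation then shows that they are equidistributed over the cosets of the subgroup of `e`-th
powers for all `e ∣ Q`, with an error of at most `(q - 1) * √(q ^ (n - 2))`
(`abs_card_traceZeroUnits_filter_sub_le`); no character sums are needed.

Since `q` is primitive modulo `n`, all prime factors of `Q` are `1` modulo `2 * n`
(`modEq_one_of_dvd_geom_sum`). They are therefore at least `7, 13, 19, …`, and there are so few of
them, compared with `Q ≤ 2 * q ^ (2 * (n - 2))`, that a plain union bound succeeds when there are at
most `15` of them and plain inclusion-exclusion succeeds when there are more.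
-/

/-! ### Primes in an arithmetic progression -/

/-- A finite set of natural numbers has an `i`-th smallest element that is at least `i`, so an
antitone function sums over it to at most the sum over an initial segment of the same size. -/
theorem Finset.sum_le_sum_range_card_of_antitone {f : ℕ → ℝ} (hf : Antitone f) (s : Finset ℕ) :
    ∑ a ∈ s, f a ≤ ∑ i ∈ Finset.range s.card, f i := by
  induction s using Finset.induction_on_max with
  | empty => simp
  | insert a s h ih =>
    have ha : a ∉ s := fun h' ↦ lt_irrefl _ (h a h')
    rw [Finset.sum_insert ha, Finset.card_insert_of_notMem ha, Finset.sum_range_succ, add_comm]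
    have : s.card ≤ a := by
      simpa using Finset.card_le_card (fun x hx ↦ Finset.mem_range.2 (h x hx))
    exact add_le_add ih (hf this)

theorem Finset.prod_range_card_le_prod_of_monotone {f : ℕ → ℝ} (hf : Monotone f)
    (h0 : ∀ i, 0 ≤ f i) (s : Finset ℕ) :
    ∏ i ∈ Finset.range s.card, f i ≤ ∏ a ∈ s, f a := by
  induction s using Finset.induction_on_max with
  | empty => simp
  | insert a s h ih =>
    have ha : a ∉ s := fun h' ↦ lt_irrefl _ (h a h')
    rw [Finset.prod_insert ha, Finset.card_insert_of_notMem ha, Finset.prod_range_succ, mul_comm]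
    have : s.card ≤ a := by
      simpa using Finset.card_le_card (fun x hx ↦ Finset.mem_range.2 (h x hx))
    exact mul_le_mul (hf this) ih (Finset.prod_nonneg fun i _ ↦ h0 i) (h0 a)

/-- Distinct integers that are `1` modulo `2 * n`, with `n ≥ 3`, can be bounded below one by one by
`7, 13, 19, …`. -/
theorem exists_indices_of_modEq_one {n : ℕ} (hn : 3 ≤ n) (P : Finset ℕ)
    (hP : ∀ l ∈ P, 1 < l ∧ l ≡ 1 [MOD 2 * n]) :
    ∃ s : Finset ℕ, ∃ e : ℕ → ℕ, s.card = P.card ∧ Set.InjOn e P ∧ P.image e = s ∧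
      ∀ l ∈ P, (6 * e l + 7 : ℝ) ≤ l := by
  have key : ∀ l ∈ P, ∃ j, l = 2 * n * (j + 1) + 1 := by
    intro l hl
    obtain ⟨h1, h2⟩ := hP l hl
    obtain ⟨c, hc⟩ := (Nat.modEq_iff_dvd' h1.le).1 h2.symm
    rcases c with _ | c
    · omega
    · exact ⟨c, by omega⟩
  choose! e he using key
  have inj : Set.InjOn e P := fun a ha b hb hab ↦ by rw [he a ha, he b hb, hab]
  refine ⟨P.image e, e, Finset.card_image_of_injOn inj, inj, rfl, fun l hl ↦ ?_⟩
  have h : 6 * e l + 7 ≤ l := by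
    have := he l hl
    nlinarith [Nat.mul_le_mul hn (le_refl (e l + 1))]
  exact_mod_cast h

theorem sum_inv_le_of_modEq_one {n : ℕ} (hn : 3 ≤ n) (P : Finset ℕ)
    (hP : ∀ l ∈ P, 1 < l ∧ l ≡ 1 [MOD 2 * n]) :
    ∑ l ∈ P, (l : ℝ)⁻¹ ≤ ∑ i ∈ Finset.range P.card, (6 * i + 7 : ℝ)⁻¹ := by
  obtain ⟨s, e, hs, inj, rfl, h⟩ := exists_indices_of_modEq_one hn P hP
  rw [← hs]
  refine le_trans ?_ (Finset.sum_le_sum_range_card_of_antitone (f := fun i ↦ (6 * i + 7 : ℝ)⁻¹)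
    (fun a b hab ↦ by dsimp only; gcongr) _)
  rw [Finset.sum_image inj]
  exact Finset.sum_le_sum fun l hl ↦ inv_anti₀ (by positivity) (h l hl)

theorem prod_le_prod_of_modEq_one {n : ℕ} (hn : 3 ≤ n) (P : Finset ℕ)
    (hP : ∀ l ∈ P, 1 < l ∧ l ≡ 1 [MOD 2 * n]) :
    ∏ i ∈ Finset.range P.card, (6 * i + 7 : ℝ) ≤ ∏ l ∈ P, (l : ℝ) := by
  obtain ⟨s, e, hs, inj, rfl, h⟩ := exists_indices_of_modEq_one hn P hP
  rw [← hs]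
  refine (Finset.prod_range_card_le_prod_of_monotone (f := fun i ↦ (6 * i + 7 : ℝ))
    (fun a b hab ↦ by dsimp only; gcongr) (fun i ↦ by positivity) _).trans ?_
  rw [Finset.prod_image inj]
  exact Finset.prod_le_prod (fun l hl ↦ by positivity) h

/-- The crude bound `l ≥ i + 2` for the `i`-th element makes the product telescope. -/
theorem inv_card_succ_le_prod_one_sub_inv {n : ℕ} (hn : 3 ≤ n) (P : Finset ℕ)
    (hP : ∀ l ∈ P, 1 < l ∧ l ≡ 1 [MOD 2 * n]) :
    ((P.card : ℝ) + 1)⁻¹ ≤ ∏ l ∈ P, (1 - (l : ℝ)⁻¹) := by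
  obtain ⟨s, e, hs, inj, rfl, h⟩ := exists_indices_of_modEq_one hn P hP
  have tel : ∀ w : ℕ, ∏ i ∈ Finset.range w, (1 - (i + 2 : ℝ)⁻¹) = ((w : ℝ) + 1)⁻¹ := by
    intro w
    induction w with
    | zero => simp
    | succ w ih => rw [Finset.prod_range_succ, ih]; push_cast; field_simp; ring
  have nn : ∀ i : ℕ, 0 ≤ 1 - (i + 2 : ℝ)⁻¹ := fun i ↦
    sub_nonneg.2 (inv_le_one_of_one_le₀ (by linarith [(Nat.cast_nonneg i : (0 : ℝ) ≤ i)]))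
  rw [← tel, ← hs]
  refine (Finset.prod_range_card_le_prod_of_monotone (f := fun i ↦ (1 - (i + 2 : ℝ)⁻¹))
    (fun a b hab ↦ by dsimp only; gcongr) nn _).trans ?_
  rw [Finset.prod_image inj]
  refine Finset.prod_le_prod (fun l hl ↦ nn _) fun l hl ↦ ?_
  have := h l hl
  gcongr
  linarith

/-- The numerical condition for the union bound over `w` primes: if their product is at most
`2 * m ^ 2`, it gives `w < √m * (1 - ∑ 1 / l)`, that is, the errors stay below the main term. -/
theorem two_mul_pow_four_lt_prod {w : ℕ} (hw : w ≤ 15) :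
    ∑ i ∈ Finset.range w, (6 * i + 7 : ℝ)⁻¹ < 1 ∧ 2 * (w : ℝ) ^ 4 <
      (∏ i ∈ Finset.range w, (6 * i + 7 : ℝ)) *
        (1 - ∑ i ∈ Finset.range w, (6 * i + 7 : ℝ)⁻¹) ^ 4 := by
  interval_cases w <;> norm_num [Finset.sum_range_succ, Finset.prod_range_succ]

/-- The numerical condition for inclusion-exclusion over `w` primes: if their product is at most
`2 * m ^ 2`, it gives `2 ^ w < √m / (w + 1)`, that is, the `2 ^ w` errors stay below the main
term. -/
theorem two_mul_two_pow_mul_pow_four_lt_prod {w : ℕ} (hw : 15 ≤ w) :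
    2 * ((2 : ℝ) ^ w * (w + 1)) ^ 4 < ∏ i ∈ Finset.range w, (6 * i + 7 : ℝ) := by
  induction w, hw using Nat.le_induction with
  | base => norm_num [Finset.prod_range_succ]
  | succ w hw ih =>
    rw [Finset.prod_range_succ]
    have hw' : (15 : ℝ) ≤ w := by exact_mod_cast hw
    have h4 : ((w : ℝ) + 1 + 1) ^ 4 ≤ 2 * ((w : ℝ) + 1) ^ 4 := by
      have h2 : ((w : ℝ) + 1 + 1) ^ 2 ≤ 5 / 4 * ((w : ℝ) + 1) ^ 2 := by nlinarith
      calc ((w : ℝ) + 1 + 1) ^ 4 = (((w : ℝ) + 1 + 1) ^ 2) ^ 2 := by ring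
        _ ≤ (5 / 4 * ((w : ℝ) + 1) ^ 2) ^ 2 := by gcongr
        _ ≤ 2 * ((w : ℝ) + 1) ^ 4 := by
          nlinarith [pow_nonneg (by positivity : (0 : ℝ) ≤ (w : ℝ) + 1) 4]
    calc 2 * ((2 : ℝ) ^ (w + 1) * ((w + 1 : ℕ) + 1)) ^ 4
        = 32 * ((2 : ℝ) ^ w) ^ 4 * ((w : ℝ) + 1 + 1) ^ 4 := by push_cast; ring
      _ ≤ 32 * ((2 : ℝ) ^ w) ^ 4 * (2 * ((w : ℝ) + 1) ^ 4) := by gcongr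
      _ = 2 * ((2 : ℝ) ^ w * (w + 1)) ^ 4 * 32 := by ring
      _ < (∏ i ∈ Finset.range w, (6 * i + 7 : ℝ)) * (6 * w + 7) :=
        mul_lt_mul'' ih (by linarith) (by positivity) (by norm_num)

/-! ### Equidistribution in cosets -/

section Equidistribution

variable {G : Type*} [CommGroup G] [Fintype G]

open Classical in
theorem card_filter_inv_mul_mem (H : Subgroup G) (M : Finset G) :
    ((M ×ˢ M).filter fun p ↦ p.1⁻¹ * p.2 ∈ H).card =
      ∑ h ∈ Finset.univ.filter (· ∈ H), (M.filter fun x ↦ x * h ∈ M).card := by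
  rw [← Finset.card_sigma]
  refine Finset.card_bij' (fun p _ ↦ ⟨p.1⁻¹ * p.2, p.1⟩) (fun s _ ↦ (s.2, s.2 * s.1)) ?_ ?_ ?_ ?_
  · rintro ⟨x, y⟩ h; simp at h ⊢; tauto
  · rintro ⟨x, y⟩ h; simp at h ⊢; tauto
  · rintro ⟨x, y⟩ h; simp
  · rintro ⟨x, y⟩ h; simp

open Classical in
theorem sum_card_fiber_mk_sq (H : Subgroup G) (M : Finset G) :
    ∑ c : G ⧸ H, (M.filter fun x ↦ (QuotientGroup.mk x : G ⧸ H) = c).card ^ 2 =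
      ((M ×ˢ M).filter fun p ↦ p.1⁻¹ * p.2 ∈ H).card := by
  rw [Finset.card_eq_sum_card_fiberwise (f := fun p ↦ (QuotientGroup.mk p.1 : G ⧸ H))
    (t := Finset.univ) (by simp)]
  refine Finset.sum_congr rfl fun c _ ↦ ?_
  rw [sq, ← Finset.card_product]
  congr 1
  ext ⟨x, y⟩
  simp only [Finset.mem_product, Finset.mem_filter, ← QuotientGroup.eq]
  grind

open Classical in
/-- If the number of representations of `h` as a quotient of two elements of `M` takes only one
value `A` on the subgroup `Z` and one value `B` off `Z` (a relative form of a difference set), then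
`M` is equidistributed in the cosets of every subgroup `H ≥ Z`: the variance of `|M ∩ cH|` over
the cosets can be computed exactly. -/
theorem sq_card_filter_mem_sub_le {Z H : Subgroup G} (hZH : Z ≤ H) (M : Finset G) {A B : ℝ}
    (hA : ∀ h ∈ Z, ((M.filter fun x ↦ x * h ∈ M).card : ℝ) = A)
    (hB : ∀ h ∉ Z, ((M.filter fun x ↦ x * h ∈ M).card : ℝ) = B) (hBA : B ≤ A) :
    ((M.filter (· ∈ H)).card - A / H.index : ℝ) ^ 2 ≤ Nat.card Z * (A - B) := by
  have hMA : (M.card : ℝ) = A := by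
    rw [← hA 1 Z.one_mem]; simp
  have pairs : ∀ H : Subgroup G, Z ≤ H →
      (((M ×ˢ M).filter fun p ↦ p.1⁻¹ * p.2 ∈ H).card : ℝ) =
        Nat.card Z * A + (Nat.card H - Nat.card Z) * B := by
    intro H hH
    have e1 : ∀ K : Subgroup G, ((Finset.univ.filter (· ∈ K)).card : ℝ) = Nat.card K := by
      intro K
      rw [← Nat.subtype_card (p := (· ∈ K)) _ (by simp)]
    have e2 : (Finset.univ.filter (· ∈ H)).filter (· ∈ Z) = Finset.univ.filter (· ∈ Z) := by
      ext x; simpa using @hH x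
    have e3 := Finset.card_filter_add_card_filter_not (s := Finset.univ.filter (· ∈ H)) (· ∈ Z)
    have e3' : (((Finset.univ.filter (· ∈ H)).filter (· ∉ Z)).card : ℝ) =
        Nat.card H - Nat.card Z := by
      rw [← e1 H, ← e1 Z, ← e3, e2]; push_cast; ring
    rw [card_filter_inv_mul_mem, Nat.cast_sum, ← Finset.sum_filter_add_sum_filter_not _ (· ∈ Z),
      Finset.sum_congr rfl fun h hh ↦ hA h (Finset.mem_filter.1 hh).2,
      Finset.sum_congr (s₁ := Finset.filter (· ∉ Z) _) rfl fun h hh ↦ hB h (Finset.mem_filter.1 hh).2,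
      Finset.sum_const, Finset.sum_const, nsmul_eq_mul, nsmul_eq_mul, e3', e2, e1]
  have htop : A ^ 2 = Nat.card Z * A + (Nat.card G - Nat.card Z) * B := by
    have := pairs ⊤ le_top
    rw [Subgroup.card_top] at this
    simp only [Subgroup.mem_top, Finset.filter_true, Finset.card_product, Nat.cast_mul,
      hMA] at this
    rw [← this, sq]
  set N : G ⧸ H → ℝ := fun c ↦ (M.filter fun x ↦ (QuotientGroup.mk x : G ⧸ H) = c).card with hN
  have hN1 : ∑ c, N c = A := by
    rw [← hMA, Finset.card_eq_sum_card_fiberwise (f := fun x ↦ (QuotientGroup.mk x : G ⧸ H)) (t := Finset.univ)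
      (by simp)]
    push_cast; rfl
  have hN2 : ∑ c, N c ^ 2 = Nat.card Z * A + (Nat.card H - Nat.card Z) * B := by
    rw [← pairs H hZH, ← sum_card_fiber_mk_sq]
    push_cast; rfl
  have hidx : (H.index : ℝ) ≠ 0 := by exact_mod_cast Subgroup.index_ne_zero_of_finite
  have hcard : (Nat.card H : ℝ) = Nat.card G / H.index := by
    rw [← H.card_mul_index]; push_cast; field_simp
  have hsum : ∑ c, (N c - A / H.index) ^ 2 = Nat.card Z * (A - B) * (1 - 1 / H.index) := by
    have : ∀ c, (N c - A / H.index) ^ 2 =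
        N c ^ 2 - 2 * (A / H.index) * N c + (A / H.index) ^ 2 := fun c ↦ by ring
    simp only [this, Finset.sum_add_distrib, Finset.sum_sub_distrib, ← Finset.mul_sum, hN1, hN2,
      Finset.sum_const, nsmul_eq_mul, Finset.card_univ]
    rw [← Nat.card_eq_fintype_card, ← Subgroup.index, hcard]
    field_simp
    linear_combination -htop
  have hNe : ((M.filter (· ∈ H)).card : ℝ) = N (QuotientGroup.mk 1) := by
    simp only [hN]
    congr 2
    ext x
    simp only [Finset.mem_filter, QuotientGroup.mk_one, QuotientGroup.eq_one_iff]
  calc ((M.filter (· ∈ H)).card - A / H.index : ℝ) ^ 2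
      = (N (QuotientGroup.mk 1) - A / H.index) ^ 2 := by rw [hNe]
    _ ≤ ∑ c, (N c - A / H.index) ^ 2 :=
      Finset.single_le_sum (f := fun c ↦ (N c - A / H.index) ^ 2) (fun c _ ↦ sq_nonneg _)
        (Finset.mem_univ _)
    _ = Nat.card Z * (A - B) * (1 - 1 / H.index) := hsum
    _ ≤ Nat.card Z * (A - B) := by
      apply mul_le_of_le_one_right (mul_nonneg (Nat.cast_nonneg _) (sub_nonneg.2 hBA))
      simp

end Equidistribution

/-! ### Two sieves -/

section Sieve

variable {α : Type*}

open Classical in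
/-- The union bound, for a set `M` in which each property `E l` holds with frequency about
`1 / l`. -/
theorem exists_forall_not_of_union_bound (M : Finset α) (P : Finset ℕ) (E : ℕ → α → Prop) {R : ℝ}
    (hR : ∀ l ∈ P, |((M.filter (E l)).card : ℝ) - M.card / l| ≤ R)
    (h : P.card * R < M.card * (1 - ∑ l ∈ P, (l : ℝ)⁻¹)) :
    ∃ x ∈ M, ∀ l ∈ P, ¬ E l x := by
  by_contra! hcon
  have hsub : M ⊆ P.biUnion fun l ↦ M.filter (E l) := by
    intro x hx
    obtain ⟨l, hl, hlx⟩ := hcon x hx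
    exact Finset.mem_biUnion.2 ⟨l, hl, Finset.mem_filter.2 ⟨hx, hlx⟩⟩
  have h1 : (M.card : ℝ) ≤ ∑ l ∈ P, ((M.filter (E l)).card : ℝ) := by
    exact_mod_cast (Finset.card_le_card hsub).trans Finset.card_biUnion_le
  have h2 : ∑ l ∈ P, ((M.filter (E l)).card : ℝ) ≤ ∑ l ∈ P, (M.card * (l : ℝ)⁻¹ + R) :=
    Finset.sum_le_sum fun l hl ↦ by
      have := (abs_le.1 (hR l hl)).2
      rw [div_eq_mul_inv] at this
      linarith
  rw [Finset.sum_add_distrib, ← Finset.mul_sum, Finset.sum_const, nsmul_eq_mul] at h2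
  linarith

open Classical in
/-- Inclusion-exclusion, for a set `M` in which the properties `E l` are nearly independent and
each `E l` holds with frequency about `1 / l`. -/
theorem exists_forall_not_of_inclusion_exclusion [Fintype α] (M : Finset α) (P : Finset ℕ)
    (E : ℕ → α → Prop) {R : ℝ}
    (hR : ∀ T ⊆ P, |((M.filter fun x ↦ ∀ l ∈ T, E l x).card : ℝ) - M.card / ∏ l ∈ T, (l : ℝ)| ≤ R)
    (h : 2 ^ P.card * R < M.card * ∏ l ∈ P, (1 - (l : ℝ)⁻¹)) :
    ∃ x ∈ M, ∀ l ∈ P, ¬ E l x := by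
  by_contra! hcon
  have ie := Finset.inclusion_exclusion_sum_inf_compl P (fun l ↦ Finset.univ.filter (E l))
    (fun x ↦ if x ∈ M then (1 : ℝ) else 0)
  have h0 : ∑ a ∈ P.inf fun l ↦ (Finset.univ.filter (E l))ᶜ, (if a ∈ M then (1 : ℝ) else 0) = 0 := by
    refine Finset.sum_eq_zero fun a ha ↦ if_neg fun haM ↦ ?_
    obtain ⟨l, hl, hla⟩ := hcon a haM
    simpa [hla] using Finset.inf_le (f := fun l ↦ (Finset.univ.filter (E l))ᶜ) hl ha
  have hT : ∀ T : Finset ℕ, ∑ a ∈ T.inf fun l ↦ Finset.univ.filter (E l),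
      (if a ∈ M then (1 : ℝ) else 0) = (M.filter fun x ↦ ∀ l ∈ T, E l x).card := by
    intro T
    rw [Finset.sum_boole]
    congr 2
    ext x
    simp [Finset.mem_inf, and_comm]
  have hprod : (M.card : ℝ) * ∏ l ∈ P, (1 - (l : ℝ)⁻¹) =
      ∑ T ∈ P.powerset, (-1) ^ T.card * (M.card / ∏ l ∈ T, (l : ℝ)) := by
    rw [Finset.prod_sub, Finset.mul_sum]
    refine Finset.sum_congr rfl fun T _ ↦ ?_
    rw [Finset.prod_inv_distrib, Finset.prod_const_one, div_eq_mul_inv]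
    ring
  rw [h0] at ie
  simp only [hT, zsmul_eq_mul] at ie
  have hdiff : (M.card : ℝ) * ∏ l ∈ P, (1 - (l : ℝ)⁻¹) = ∑ T ∈ P.powerset,
      (-1) ^ T.card * (M.card / ∏ l ∈ T, (l : ℝ) -
        (M.filter fun x ↦ ∀ l ∈ T, E l x).card) := by
    simp only [mul_sub, Finset.sum_sub_distrib, ← hprod]
    push_cast at ie
    linarith
  have : (M.card : ℝ) * ∏ l ∈ P, (1 - (l : ℝ)⁻¹) ≤ ∑ T ∈ P.powerset, R := by
    rw [hdiff]
    refine Finset.sum_le_sum fun T hTP ↦ ?_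
    refine (le_abs_self _).trans ?_
    rw [abs_mul, abs_pow, abs_neg, abs_one, one_pow, one_mul, abs_sub_comm]
    exact hR T (Finset.mem_powerset.1 hTP)
  rw [Finset.sum_const, Finset.card_powerset, nsmul_eq_mul] at this
  push_cast at this
  linarith

end Sieve

/-! ### Elements of trace zero in cosets of the group of `e`-th powers -/

section Trace

variable (F K : Type*) [Field F] [Field K] [Algebra F K]

/-- The multiplicative group of `F`, inside that of `K`. -/
noncomputable def baseUnits : Subgroup Kˣ := (Units.map (algebraMap F K : F →* K)).range

open Classical in
/-- The nonzero elements of `K` whose trace over `F` is zero, as a set of units. -/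
noncomputable def traceZeroUnits [Fintype K] : Finset Kˣ :=
  Finset.univ.filter fun x ↦ Algebra.trace F K x = 0

variable {F K}

theorem mem_baseUnits {x : Kˣ} : x ∈ baseUnits F K ↔ ∃ c : F, algebraMap F K c = x := by
  constructor
  · rintro ⟨c, rfl⟩
    exact ⟨c, rfl⟩
  · rintro ⟨c, hc⟩
    have : c ≠ 0 := by
      rintro rfl
      exact x.ne_zero (by rw [← hc, map_zero])
    exact ⟨Units.mk0 c this, Units.ext hc⟩

theorem card_baseUnits : Nat.card (baseUnits F K) = Nat.card F - 1 := by
  have inj : Function.Injective (Units.map (algebraMap F K : F →* K)) :=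
    Units.map_injective (algebraMap F K).injective
  rw [baseUnits, ← Nat.card_congr (MonoidHom.ofInjective inj).toEquiv, Nat.card_units]

variable [Fintype K]

theorem mem_traceZeroUnits {x : Kˣ} : x ∈ traceZeroUnits F K ↔ Algebra.trace F K x = 0 := by
  simp [traceZeroUnits]

open Classical in
theorem card_units_filter_eq_zero_of_surjective {V : Type*} [AddCommGroup V] [Module F V]
    [Module.Finite F V]
    {f : K →ₗ[F] V} (hf : Function.Surjective f) :
    ((Finset.univ.filter fun x : Kˣ ↦ f x = 0).card : ℝ) =
      (Nat.card F : ℝ) ^ (Module.finrank F K - Module.finrank F V) - 1 := by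
  have h1 : Nat.card (LinearMap.ker f) =
      Nat.card F ^ (Module.finrank F K - Module.finrank F V) := by
    rw [Module.natCard_eq_pow_finrank (K := F) (V := LinearMap.ker f),
      ← f.finrank_range_add_finrank_ker, LinearMap.range_eq_top.2 hf, finrank_top,
      Nat.add_sub_cancel_left]
  have h2 : (Finset.univ.filter fun x : K ↦ f x = 0) =
      insert 0 ((Finset.univ.filter fun x : Kˣ ↦ f x = 0).image Units.val) := by
    ext x
    simp only [Finset.mem_filter, Finset.mem_univ, true_and, Finset.mem_insert, Finset.mem_image]
    constructor
    · intro hx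
      rcases eq_or_ne x 0 with h0 | h0
      · exact Or.inl h0
      · exact Or.inr ⟨Units.mk0 x h0, hx, rfl⟩
    · rintro (rfl | ⟨u, hu, rfl⟩)
      · exact map_zero f
      · exact hu
  have h3 : Nat.card (LinearMap.ker f) = (Finset.univ.filter fun x : K ↦ f x = 0).card := by
    rw [← Nat.subtype_card (p := (· ∈ LinearMap.ker f)) _ (by simp)]
  rw [h1, h2, Finset.card_insert_of_notMem (by simp),
    Finset.card_image_of_injective _ Units.val_injective] at h3
  have h4 := congrArg (Nat.cast (R := ℝ)) h3
  push_cast at h4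
  linarith

theorem mul_mem_traceZeroUnits {x h : Kˣ} (hx : x ∈ traceZeroUnits F K) (hh : h ∈ baseUnits F K) :
    x * h ∈ traceZeroUnits F K := by
  obtain ⟨c, hc⟩ := mem_baseUnits.1 hh
  rw [mem_traceZeroUnits] at hx ⊢
  rw [Units.val_mul, ← hc, mul_comm, ← Algebra.smul_def, map_smul, hx, smul_zero]

variable [Finite F]

/-- The linear forms `x ↦ Tr x` and `x ↦ Tr (x * h)` are independent when `h ∉ F`. -/
theorem trace_prod_surjective {h : K} (hh : ∀ c : F, algebraMap F K c ≠ h) :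
    Function.Surjective ((Algebra.trace F K).prod (Algebra.trace F K ∘ₗ LinearMap.mulRight F h)) := by
  rw [← LinearMap.range_eq_top]
  by_contra hne
  obtain ⟨φ, φ0, hφ⟩ := Submodule.exists_le_ker_of_lt_top _ (lt_top_iff_ne_top.2 hne)
  have expand : ∀ a b : F, φ (a, b) = a * φ (1, 0) + b * φ (0, 1) := by
    intro a b
    have : (a, b) = a • ((1 : F), (0 : F)) + b • ((0 : F), (1 : F)) := by simp
    rw [this, map_add, map_smul, map_smul, smul_eq_mul, smul_eq_mul]
  set a := φ (1, 0)
  set b := φ (0, 1)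
  have hzero : algebraMap F K a + algebraMap F K b * h = 0 := by
    refine (traceForm_nondegenerate F K).1 _ fun x ↦ ?_
    have hx : φ (Algebra.trace F K x, Algebra.trace F K (x * h)) = 0 := hφ ⟨x, rfl⟩
    rw [expand] at hx
    rw [Algebra.traceForm_apply, add_mul, map_add, mul_assoc, ← Algebra.smul_def,
      ← Algebra.smul_def, map_smul, map_smul, mul_comm h x, smul_eq_mul, smul_eq_mul]
    linear_combination hx
  have hb : b = 0 := by
    by_contra hb
    refine hh (-a / b) ?_
    have : algebraMap F K b ≠ 0 := by simpa using hb
    rw [map_div₀, map_neg]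
    field_simp
    linear_combination -hzero
  have ha : a = 0 := by simpa [hb] using hzero
  refine φ0 (LinearMap.ext fun ⟨x, y⟩ ↦ ?_)
  rw [expand, ha, hb]
  simp

open Classical in
theorem card_traceZeroUnits : ((traceZeroUnits F K).card : ℝ) =
    (Nat.card F : ℝ) ^ (Module.finrank F K - 1) - 1 := by
  have := card_units_filter_eq_zero_of_surjective (Algebra.trace_surjective F K)
  rw [Module.finrank_self] at this
  rw [← this, traceZeroUnits]

open Classical in
theorem card_traceZeroUnits_filter_of_mem {h : Kˣ} (hh : h ∈ baseUnits F K) :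
    (((traceZeroUnits F K).filter fun x ↦ x * h ∈ traceZeroUnits F K).card : ℝ) =
      (Nat.card F : ℝ) ^ (Module.finrank F K - 1) - 1 := by
  rw [← card_traceZeroUnits, Finset.filter_true_of_mem]
  exact fun x hx ↦ mul_mem_traceZeroUnits hx hh

open Classical in
theorem card_traceZeroUnits_filter_of_notMem {h : Kˣ} (hh : h ∉ baseUnits F K) :
    (((traceZeroUnits F K).filter fun x ↦ x * h ∈ traceZeroUnits F K).card : ℝ) =
      (Nat.card F : ℝ) ^ (Module.finrank F K - 2) - 1 := by
  have := card_units_filter_eq_zero_of_surjective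
    (trace_prod_surjective (F := F) (K := K) (h := h) fun c hc ↦ hh (mem_baseUnits.2 ⟨c, hc⟩))
  rw [Module.finrank_prod, Module.finrank_self] at this
  rw [← this]
  congr 2
  ext x
  simp [mem_traceZeroUnits]

open Classical in
/-- The elements of trace zero are equidistributed over the cosets of every subgroup that contains
the multiplicative group of `F`; the error is of the size of the square root of the main term. -/
theorem abs_card_traceZeroUnits_filter_sub_le (hn : 2 ≤ Module.finrank F K) {H : Subgroup Kˣ}
    (hH : baseUnits F K ≤ H) :
    |(((traceZeroUnits F K).filter (· ∈ H)).card : ℝ) - (traceZeroUnits F K).card / H.index| ≤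
      (Nat.card F - 1) * √((Nat.card F : ℝ) ^ (Module.finrank F K - 2)) := by
  have hq : (1 : ℝ) < Nat.card F := by exact_mod_cast Finite.one_lt_card
  obtain ⟨m, hm⟩ : ∃ m, Module.finrank F K = m + 2 := ⟨_, (Nat.sub_add_cancel hn).symm⟩
  have key := sq_card_filter_mem_sub_le hH (traceZeroUnits F K)
    (fun h hh ↦ by convert card_traceZeroUnits_filter_of_mem hh)
    (fun h hh ↦ by convert card_traceZeroUnits_filter_of_notMem hh)
    (sub_le_sub_right (pow_le_pow_right₀ hq.le (by omega)) 1)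
  rw [← card_traceZeroUnits] at key
  refine abs_le_of_sq_le_sq (key.trans_eq ?_) (mul_nonneg (by linarith) (Real.sqrt_nonneg _))
  rw [card_traceZeroUnits, mul_pow, Real.sq_sqrt (by positivity), card_baseUnits,
    Nat.cast_sub Finite.one_lt_card.le, hm]
  simp only [Nat.add_sub_cancel, show m + 2 - 1 = m + 1 by omega]
  push_cast
  ring

end Trace

/-! ### Prime factors of `(q ^ n - 1) / (q - 1)` -/

theorem modEq_one_of_dvd_geom_sum {q n l : ℕ} (hn : n.Prime) (h3 : 3 ≤ n)
    (hq : IsPrimitiveElt (q : ZMod n)) (hl : l.Prime)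
    (hdvd : l ∣ ∑ i ∈ Finset.range n, q ^ i) : l ≡ 1 [MOD 2 * n] := by
  have : Fact n.Prime := ⟨hn⟩
  have : Fact l.Prime := ⟨hl⟩
  have hsum : ∑ i ∈ Finset.range n, (q : ZMod l) ^ i = 0 := by
    have := (ZMod.natCast_eq_zero_iff _ _).2 hdvd
    push_cast at this
    exact this
  have hpow : (q : ZMod l) ^ n = 1 := by
    have := geom_sum_mul (q : ZMod l) n
    rw [hsum, zero_mul] at this
    exact (sub_eq_zero.1 this.symm)
  have hne : (q : ZMod l) ≠ 1 := by
    intro h1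
    -- Then `l = n`, and `q` is trivial modulo `n`, where it should have order `n - 1`.
    rw [h1] at hsum
    have hln : l = n := by
      rw [← Nat.prime_dvd_prime_iff_eq hl hn, ← ZMod.natCast_eq_zero_iff]
      simpa using hsum
    subst hln
    obtain ⟨u, hu, hgen⟩ := hq
    have hu1 : u = 1 := Units.ext (by rw [hu, h1, Units.val_one])
    have hcard := orderOf_eq_card_of_forall_mem_zpowers hgen
    rw [hu1, orderOf_one, Nat.card_units, Nat.card_zmod] at hcard
    omega
  have hord : n ∣ l - 1 := by
    rw [← orderOf_eq_prime hpow hne]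
    refine ZMod.orderOf_dvd_card_sub_one fun h0 ↦ ?_
    rw [h0, zero_pow hn.ne_zero] at hpow
    exact zero_ne_one hpow
  have hl1 := hl.one_lt
  have hnl : n ≤ l - 1 := Nat.le_of_dvd (by omega) hord
  have h2l : 2 ∣ l - 1 := by
    obtain ⟨k, hk⟩ := hl.odd_of_ne_two (by omega)
    exact ⟨k, by omega⟩
  have hcop : Nat.Coprime 2 n := (Nat.coprime_primes Nat.prime_two hn).2 (by omega)
  exact ((Nat.modEq_iff_dvd' hl1.le).2 (hcop.mul_dvd_of_dvd_of_dvd h2l hord)).symm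

theorem geom_sum_le_two_mul_sq {q n : ℕ} (hq : 2 ≤ q) (hn : 3 ≤ n) :
    ∑ i ∈ Finset.range n, q ^ i ≤ 2 * (q ^ (n - 2)) ^ 2 := by
  obtain ⟨m, rfl⟩ : ∃ m, n = m + 1 := ⟨n - 1, by omega⟩
  have h1 : ∑ i ∈ Finset.range (m + 1), q ^ i < 2 * q ^ m := by
    rw [Finset.sum_range_succ, two_mul]
    exact Nat.add_lt_add_right (Nat.geomSum_lt hq fun i hi ↦ Finset.mem_range.1 hi) _
  have h2 : q ^ m ≤ (q ^ (m + 1 - 2)) ^ 2 := by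
    rw [← pow_mul]
    exact Nat.pow_le_pow_right (by omega) (by omega)
  omega

/-! ### Powers in a finite cyclic group -/

section Cyclic

variable {G : Type*} [CommGroup G] [Finite G]

theorem pow_mem_range_powMonoidHom_iff {g : G} (hg : ∀ x, x ∈ Subgroup.zpowers g) {l : ℕ}
    (hl : l ∣ Nat.card G) (a : ℕ) : g ^ a ∈ (powMonoidHom l : G →* G).range ↔ l ∣ a := by
  constructor
  · rintro ⟨y, hy⟩
    obtain ⟨b, rfl⟩ := mem_powers_iff_mem_zpowers.2 (hg y)
    simp only [powMonoidHom_apply, ← pow_mul] at hy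
    rw [pow_eq_pow_iff_modEq, orderOf_eq_card_of_forall_mem_zpowers hg] at hy
    exact (hy.dvd_iff hl).1 (dvd_mul_left _ _)
  · rintro ⟨b, rfl⟩
    exact ⟨g ^ b, by simp [← pow_mul, mul_comm]⟩

theorem forall_mem_range_powMonoidHom_iff [IsCyclic G] {T : Finset ℕ}
    (hT : ∀ l ∈ T, l.Prime) (hTG : ∏ l ∈ T, l ∣ Nat.card G) (x : G) :
    (∀ l ∈ T, x ∈ (powMonoidHom l : G →* G).range) ↔
      x ∈ (powMonoidHom (∏ l ∈ T, l) : G →* G).range := by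
  obtain ⟨g, hg⟩ := IsCyclic.exists_generator (α := G)
  obtain ⟨a, rfl⟩ := mem_powers_iff_mem_zpowers.2 (hg x)
  simp only
  rw [pow_mem_range_powMonoidHom_iff hg hTG]
  constructor
  · intro h
    refine Finset.prod_primes_dvd a (fun l hl ↦ (hT l hl).prime) fun l hl ↦ ?_
    exact (pow_mem_range_powMonoidHom_iff hg ((Finset.dvd_prod_of_mem _ hl).trans hTG) a).1 (h l hl)
  · intro h l hl
    exact (pow_mem_range_powMonoidHom_iff hg ((Finset.dvd_prod_of_mem _ hl).trans hTG) a).2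
      ((Finset.dvd_prod_of_mem _ hl).trans h)

end Cyclic

/-! ### Primitive elements of trace zero -/

section Existence

variable {F K : Type*} [Field F] [Field K] [Fintype K] [Algebra F K]

theorem pow_geom_sum_mem_baseUnits (y : Kˣ) :
    y ^ ∑ i ∈ Finset.range (Module.finrank F K), Nat.card F ^ i ∈ baseUnits F K :=
  mem_baseUnits.2 ⟨Algebra.norm F (y : K), by
    rw [FiniteField.algebraMap_norm_eq_pow_sum, Units.val_pow_eq_pow_val]⟩

/-- The elements of `F` are norms, that is, powers with exponent `(q ^ n - 1) / (q - 1)`. -/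
theorem baseUnits_le_range_powMonoidHom {e : ℕ}
    (he : e ∣ ∑ i ∈ Finset.range (Module.finrank F K), Nat.card F ^ i) :
    baseUnits F K ≤ (powMonoidHom e : Kˣ →* Kˣ).range := by
  rintro x hx
  obtain ⟨c, hc⟩ := mem_baseUnits.1 hx
  obtain ⟨y, rfl⟩ := FiniteField.norm_surjective F K c
  have hy : y ≠ 0 := by
    rintro rfl
    exact x.ne_zero (by rw [← hc, Algebra.norm_zero, map_zero])
  obtain ⟨k, hk⟩ := he
  refine ⟨Units.mk0 y hy ^ k, Units.ext ?_⟩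
  rw [← hc, FiniteField.algebraMap_norm_eq_pow_sum, hk]
  simp [← pow_mul, mul_comm]

variable [Finite F]

theorem geom_sum_mul_card_sub_one :
    (∑ i ∈ Finset.range (Module.finrank F K), Nat.card F ^ i) * (Nat.card F - 1) =
      Nat.card Kˣ := by
  have hq : 1 < Nat.card F := Finite.one_lt_card
  rw [Nat.card_units, Module.natCard_eq_pow_finrank (K := F) (V := K), Nat.geomSum_eq hq]
  exact Nat.div_mul_cancel (by simpa using Nat.sub_dvd_pow_sub_pow (Nat.card F) 1 _)

/-- An element of trace zero that is not an `l`-th power for any prime `l` dividing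
`Q = (q ^ n - 1) / (q - 1)` can be made primitive by a factor from `F`, which keeps the trace zero:
an exponent prime to `Q` is congruent modulo `Q` to one prime to `q ^ n - 1`. -/
theorem exists_isPrimitiveElt_of_forall_notMem_range {x : Kˣ} (hx : x ∈ traceZeroUnits F K)
    (hxl : ∀ l ∈ (∑ i ∈ Finset.range (Module.finrank F K), Nat.card F ^ i).primeFactors,
      x ∉ (powMonoidHom l : Kˣ →* Kˣ).range) :
    ∃ α : K, IsPrimitiveElt α ∧ α ≠ 0 ∧ Algebra.trace F K α = 0 := by
  obtain ⟨g, hg⟩ := IsCyclic.exists_generator (α := Kˣ)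
  obtain ⟨a, rfl⟩ := mem_powers_iff_mem_zpowers.2 (hg x)
  simp only at hx hxl
  have hQN := geom_sum_mul_card_sub_one (F := F) (K := K)
  have hbase := pow_geom_sum_mem_baseUnits (F := F) (K := K)
  set Q := ∑ i ∈ Finset.range (Module.finrank F K), Nat.card F ^ i
  have hN0 : Nat.card Kˣ ≠ 0 := Nat.card_pos.ne'
  have hQ0 : Q ≠ 0 := fun h ↦ hN0 (by rw [← hQN, h, zero_mul])
  have hdvd : Q ∣ Nat.card Kˣ := ⟨_, hQN.symm⟩
  have hcop : a.Coprime Q := by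
    refine Nat.Coprime.symm (Nat.coprime_of_dvd fun l hl hlQ hla ↦ ?_)
    exact hxl l (Nat.mem_primeFactors.2 ⟨hl, hlQ, hQ0⟩)
      ((pow_mem_range_powMonoidHom_iff hg (hlQ.trans hdvd) a).2 hla)
  have : NeZero (Nat.card Kˣ) := ⟨hN0⟩
  obtain ⟨v, hv⟩ := ZMod.unitsMap_surjective hdvd (ZMod.unitOfCoprime a hcop)
  set b := (v : ZMod (Nat.card Kˣ)).val
  have hb : b.Coprime (orderOf g) := by
    rw [orderOf_eq_card_of_forall_mem_zpowers hg]
    exact ZMod.val_coe_unit_coprime v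
  have hab : a ≡ b [MOD Q] := by
    rw [← ZMod.natCast_eq_natCast_iff]
    have := congrArg Units.val hv
    rw [ZMod.unitsMap_val, ZMod.coe_unitOfCoprime] at this
    rw [← this, ZMod.natCast_val]
  obtain ⟨t, ht⟩ := (Nat.modEq_iff_dvd).1 hab
  have hgb : g ^ b = g ^ a * (g ^ t) ^ Q := by
    rw [← zpow_natCast, ← zpow_natCast, ← zpow_natCast, ← zpow_mul, ← zpow_add]
    congr 1
    linear_combination ht
  refine ⟨(g ^ b : Kˣ), ⟨g ^ b, rfl, fun y ↦ ?_⟩, Units.ne_zero _, ?_⟩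
  · obtain ⟨c, hc⟩ := exists_pow_eq_self_of_coprime hb
    refine (Subgroup.zpowers_le.2 ?_) (hg y)
    exact ⟨c, by simpa using hc⟩
  · rw [← mem_traceZeroUnits, hgb]
    exact mul_mem_traceZeroUnits hx (hbase _)

/-- All prime factors of `Q = (q ^ n - 1) / (q - 1)` are `1` modulo `2 * n`, which makes them so
sparse that one of the two sieves always applies: the union bound when `Q` has at most `15` prime
factors, and inclusion-exclusion otherwise. -/
theorem exists_isPrimitiveElt_trace_eq_zero (hn : (Module.finrank F K).Prime)
    (h3 : 3 ≤ Module.finrank F K)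
    (hq : IsPrimitiveElt (Nat.card F : ZMod (Module.finrank F K))) :
    ∃ α : K, IsPrimitiveElt α ∧ α ≠ 0 ∧ Algebra.trace F K α = 0 := by
  classical
  have hq2 : 2 ≤ Nat.card F := Finite.one_lt_card
  have hQle := geom_sum_le_two_mul_sq hq2 h3
  have hQN : (∑ i ∈ Finset.range (Module.finrank F K), Nat.card F ^ i) ∣ Nat.card Kˣ :=
    ⟨_, geom_sum_mul_card_sub_one.symm⟩
  have hP : ∀ l ∈ (∑ i ∈ Finset.range (Module.finrank F K), Nat.card F ^ i).primeFactors,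
      1 < l ∧ l ≡ 1 [MOD 2 * Module.finrank F K] := fun l hl ↦
    ⟨(Nat.prime_of_mem_primeFactors hl).one_lt, modEq_one_of_dvd_geom_sum hn h3 hq
      (Nat.prime_of_mem_primeFactors hl) (Nat.dvd_of_mem_primeFactors hl)⟩
  have hbase : ∀ e : ℕ, e ∣ ∑ i ∈ Finset.range (Module.finrank F K), Nat.card F ^ i →
      baseUnits F K ≤ (powMonoidHom e : Kˣ →* Kˣ).range := fun e he ↦
    baseUnits_le_range_powMonoidHom he
  suffices ∃ x ∈ traceZeroUnits F K,
      ∀ l ∈ (∑ i ∈ Finset.range (Module.finrank F K), Nat.card F ^ i).primeFactors,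
        ¬ x ∈ (powMonoidHom l : Kˣ →* Kˣ).range by
    obtain ⟨x, hx, hxl⟩ := this
    exact exists_isPrimitiveElt_of_forall_notMem_range hx hxl
  set Q := ∑ i ∈ Finset.range (Module.finrank F K), Nat.card F ^ i with hQ
  set P := Q.primeFactors
  set n := Module.finrank F K
  have hQ0 : Q ≠ 0 := fun h ↦ Nat.card_pos.ne' (Nat.eq_zero_of_zero_dvd (h ▸ hQN))
  set m : ℝ := (Nat.card F : ℝ) ^ (n - 2) with hm
  have hq1 : (0 : ℝ) < Nat.card F - 1 := by
    have : (2 : ℝ) ≤ Nat.card F := by exact_mod_cast hq2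
    linarith
  have hm1 : 1 ≤ m := one_le_pow₀ (by linarith)
  have hM : (Nat.card F - 1) * m ≤ ((traceZeroUnits F K).card : ℝ) := by
    rw [card_traceZeroUnits, show Module.finrank F K - 1 = n - 2 + 1 by omega, pow_succ, ← hm]
    linarith
  have hPm : ∏ i ∈ Finset.range P.card, (6 * i + 7 : ℝ) ≤ 2 * √m ^ 4 := by
    refine (prod_le_prod_of_modEq_one h3 P hP).trans ?_
    rw [show 4 = 2 * 2 by rfl, pow_mul, Real.sq_sqrt (by linarith)]
    have := (Nat.le_of_dvd (Nat.pos_of_ne_zero hQ0) (Nat.prod_primeFactors_dvd Q)).trans hQle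
    rw [hm, ← Nat.cast_prod]
    exact_mod_cast this
  have herr : ∀ T ⊆ P, |(((traceZeroUnits F K).filter fun x ↦
      ∀ l ∈ T, x ∈ (powMonoidHom l : Kˣ →* Kˣ).range).card : ℝ) -
        (traceZeroUnits F K).card / ∏ l ∈ T, (l : ℝ)| ≤ (Nat.card F - 1) * √m := by
    intro T hT
    have hTQ : ∏ l ∈ T, l ∣ Q :=
      (Finset.prod_dvd_prod_of_subset _ _ _ hT).trans (Nat.prod_primeFactors_dvd Q)
    have hidx : (powMonoidHom (∏ l ∈ T, l) : Kˣ →* Kˣ).range.index = ∏ l ∈ T, l := by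
      rw [IsCyclic.index_powMonoidHom_range, Nat.gcd_eq_right (hTQ.trans hQN)]
    have := abs_card_traceZeroUnits_filter_sub_le (F := F) (K := K) (by omega) (hbase _ hTQ)
    rw [hidx, Nat.cast_prod] at this
    simp only [forall_mem_range_powMonoidHom_iff
      (fun l hl ↦ Nat.prime_of_mem_primeFactors (hT hl)) (hTQ.trans hQN)]
    convert this
  have hsm : √m * √m = m := Real.mul_self_sqrt (by linarith)
  have hsm0 : 0 < √m := Real.sqrt_pos.2 (by linarith)
  rcases le_total P.card 15 with hw | hw
  · obtain ⟨hσ, hw4⟩ := two_mul_pow_four_lt_prod hw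
    set σ := ∑ i ∈ Finset.range P.card, (6 * i + 7 : ℝ)⁻¹
    have hlt : (P.card : ℝ) < √m * (1 - σ) := by
      refine lt_of_pow_lt_pow_left₀ 4 (mul_nonneg hsm0.le (by linarith)) ?_
      have := mul_le_mul_of_nonneg_right hPm (pow_nonneg (by linarith : 0 ≤ 1 - σ) 4)
      rw [mul_pow]
      linarith
    refine exists_forall_not_of_union_bound _ P _ (R := (Nat.card F - 1) * √m) (fun l hl ↦ ?_) ?_
    · simpa using herr {l} (Finset.singleton_subset_iff.2 hl)
    · calc (P.card : ℝ) * ((Nat.card F - 1) * √m)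
          < √m * (1 - σ) * ((Nat.card F - 1) * √m) :=
            mul_lt_mul_of_pos_right hlt (mul_pos hq1 hsm0)
        _ = (Nat.card F - 1) * m * (1 - σ) := by
          linear_combination ((Nat.card F : ℝ) - 1) * (1 - σ) * hsm
        _ ≤ (traceZeroUnits F K).card * (1 - ∑ l ∈ P, (l : ℝ)⁻¹) :=
          mul_le_mul hM (sub_le_sub_left (sum_inv_le_of_modEq_one h3 P hP) 1) (by linarith)
            (Nat.cast_nonneg _)
  · have hlt : (2 : ℝ) ^ P.card * (P.card + 1) < √m := by
      refine lt_of_pow_lt_pow_left₀ 4 hsm0.le ?_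
      linarith [two_mul_two_pow_mul_pow_four_lt_prod hw]
    have hw0 : 0 < ((P.card : ℝ) + 1)⁻¹ := inv_pos.2 (Nat.cast_add_one_pos _)
    refine exists_forall_not_of_inclusion_exclusion _ P
      (fun l x ↦ x ∈ (powMonoidHom l : Kˣ →* Kˣ).range) (R := (Nat.card F - 1) * √m)
      (fun T hT ↦ by convert herr T hT) ?_
    calc (2 : ℝ) ^ P.card * ((Nat.card F - 1) * √m)
        = 2 ^ P.card * (P.card + 1) * ((Nat.card F - 1) * √m) * ((P.card : ℝ) + 1)⁻¹ := by
          field_simp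
      _ < √m * ((Nat.card F - 1) * √m) * ((P.card : ℝ) + 1)⁻¹ :=
        mul_lt_mul_of_pos_right (mul_lt_mul_of_pos_right hlt (mul_pos hq1 hsm0)) hw0
      _ = (Nat.card F - 1) * m * ((P.card : ℝ) + 1)⁻¹ := by
        linear_combination ((Nat.card F : ℝ) - 1) * ((P.card : ℝ) + 1)⁻¹ * hsm
      _ ≤ (traceZeroUnits F K).card * ∏ l ∈ P, (1 - (l : ℝ)⁻¹) :=
        mul_le_mul hM (inv_card_succ_le_prod_one_sub_inv h3 P hP) hw0.le (Nat.cast_nonneg _)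

end Existence

/-! ### Trace zero and 1-normality -/

section Normality

variable {F K : Type*} [Field F] [Field K] [Finite K] [Algebra F K]

theorem eval_one_conjugatePoly (α : K) :
    (conjugatePoly F α).eval 1 = algebraMap F K (Algebra.trace F K α) := by
  simp [conjugatePoly, eval_finsetSum, FiniteField.algebraMap_trace_eq_sum_pow]

theorem natDegree_conjugatePoly_lt (α : K) :
    (conjugatePoly F α).natDegree < Module.finrank F K := by
  have hn : 0 < Module.finrank F K := Module.finrank_pos
  refine (natDegree_sum_le_of_forall_le _ _ (n := Module.finrank F K - 1) fun i _ ↦ ?_).trans_lt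
    (by omega)
  exact (natDegree_C_mul_X_pow_le _ _).trans (by omega)

theorem conjugatePoly_ne_zero {α : K} (hα : α ≠ 0) : conjugatePoly F α ≠ 0 := by
  have hn : 0 < Module.finrank F K := Module.finrank_pos
  intro h
  have := congrArg (coeff · (Module.finrank F K - 1)) h
  simp only [conjugatePoly, finsetSum_coeff, coeff_C_mul_X_pow, coeff_zero] at this
  rw [Finset.sum_eq_single 0] at this
  · simp [hα] at this
  · intro i hi hi0
    rw [Finset.mem_range] at hi
    exact if_neg (by omega)
  · simp [hn.ne']

/-- The roots of `conjugatePoly F α` among the `n`-th roots of unity are stable under the Frobenius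
map: it permutes the coefficients cyclically. -/
theorem eval_pow_card_conjugatePoly_eq_zero [Finite F] {L : Type*} [Field L] [Algebra K L] {α : K}
    {z : L} (hz : z ^ Module.finrank F K = 1)
    (h : ((conjugatePoly F α).map (algebraMap K L)).eval z = 0) :
    ((conjugatePoly F α).map (algebraMap K L)).eval (z ^ Nat.card F) = 0 := by
  have hn : 0 < Module.finrank F K := Module.finrank_pos
  obtain ⟨m, hm⟩ : ∃ m, Module.finrank F K = m + 1 := ⟨_, (Nat.succ_pred hn.ne').symm⟩
  have hcard : Nat.card F ^ (m + 1) = Nat.card K := by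
    rw [← hm, Module.natCard_eq_pow_finrank (K := F) (V := K)]
  have hα : α ^ Nat.card F ^ (m + 1) = α := by
    have := Fintype.ofFinite K
    rw [hcard, Nat.card_eq_fintype_card, FiniteField.pow_card]
  have expand : ∀ w : L, ((conjugatePoly F α).map (algebraMap K L)).eval w =
      ∑ i ∈ Finset.range (m + 1), algebraMap K L (α ^ Nat.card F ^ i) * w ^ (m - i) := by
    intro w
    simp [conjugatePoly, Polynomial.map_sum, eval_finsetSum, hm]
  have frob : ∀ x y : L, (x + y) ^ Nat.card F = x ^ Nat.card F + y ^ Nat.card F := by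
    intro x y
    let := Fintype.ofFinite F
    obtain ⟨p, hp⟩ := CharP.exists F
    have : CharP L p := by
      have := charP_of_injective_algebraMap (algebraMap F K).injective p
      exact charP_of_injective_algebraMap (algebraMap K L).injective p
    obtain ⟨e, hpp, he⟩ := FiniteField.card F p
    have : Fact p.Prime := ⟨hpp⟩
    rw [Nat.card_eq_fintype_card, he, add_pow_char_pow]
  have frobsum : ∀ (s : Finset ℕ) (f : ℕ → L),
      (∑ i ∈ s, f i) ^ Nat.card F = ∑ i ∈ s, f i ^ Nat.card F := by
    intro s f
    have := map_sum (⟨⟨fun x : L ↦ x ^ Nat.card F, by simp [Nat.card_pos.ne']⟩, frob⟩ : L →+ L) f s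
    exact this
  rw [expand] at h ⊢
  have h1 := congrArg (· ^ Nat.card F) h
  simp only [frobsum, zero_pow (Nat.card_pos (α := F)).ne', mul_pow, ← map_pow, ← pow_mul,
    ← pow_succ] at h1
  have hz0 : z ≠ 0 := fun h0 ↦ by simp [h0, hn.ne'] at hz
  refine (mul_eq_zero.1 (?_ : z ^ Nat.card F * _ = 0)).resolve_left (pow_ne_zero _ hz0)
  rw [← h1, Finset.mul_sum, Finset.sum_range_succ', Finset.sum_range_succ _ m]
  congr 1
  · refine Finset.sum_congr rfl fun i hi ↦ ?_
    rw [Finset.mem_range] at hi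
    obtain ⟨j, rfl⟩ : ∃ j, m = i + 1 + j := ⟨m - (i + 1), by omega⟩
    rw [show i + 1 + j - (i + 1) = j by omega, show i + 1 + j - i = j + 1 by omega]
    ring
  · have : z ^ Nat.card F * (z ^ Nat.card F) ^ m = 1 := by
      rw [← pow_succ', ← pow_mul, mul_comm, pow_mul, ← hm, hz, one_pow]
    rw [hα, mul_left_comm, Nat.sub_zero, this]
    simp

/-- If `q` is primitive modulo the prime `n`, then a nonzero element of trace zero is
1-normal: by stability under Frobenius, a root of unity `z ≠ 1` that is a root of
`conjugatePoly F α` would bring all its powers, hence `n` roots in total. -/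
theorem isKNormal_one_of_trace_eq_zero [Finite F] {p : ℕ} [CharP F p]
    (hn : (Module.finrank F K).Prime) (hnp : Module.finrank F K ≠ p)
    (hq : IsPrimitiveElt (Nat.card F : ZMod (Module.finrank F K)))
    {α : K} (hα : α ≠ 0) (htr : Algebra.trace F K α = 0) : IsKNormal F 1 α := by
  classical
  refine ⟨hn.one_lt, ?_⟩
  set n := Module.finrank F K with hn'
  set g := conjugatePoly F α with hg
  have hg0 : g ≠ 0 := conjugatePoly_ne_zero hα
  have hnK : (n : K) ≠ 0 := by
    have := charP_of_injective_algebraMap (algebraMap F K).injective p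
    rw [Ne, CharP.cast_eq_zero_iff K p]
    intro hdvd
    rcases (Nat.dvd_prime hn).1 hdvd with h1 | h1
    · exact CharP.char_ne_one F p h1
    · exact hnp h1.symm
  set d := EuclideanDomain.gcd (X ^ n - 1 : K[X]) g with hd
  have hd0 : d ≠ 0 := fun h ↦ hg0 (EuclideanDomain.gcd_eq_zero_iff.1 h).2
  have hdX : d ∣ X ^ n - 1 := EuclideanDomain.gcd_dvd_left _ _
  have hdg : d ∣ g := EuclideanDomain.gcd_dvd_right _ _
  have hXd : X - C 1 ∣ d := by
    refine EuclideanDomain.dvd_gcd ?_ ?_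
    · rw [dvd_iff_isRoot]; simp
    · rw [dvd_iff_isRoot, IsRoot, hg, eval_one_conjugatePoly, htr, map_zero]
  refine le_antisymm ?_ ((natDegree_X_sub_C (1 : K)).ge.trans (natDegree_le_of_dvd hXd hd0))
  let L := AlgebraicClosure K
  have hsep : d.Separable := (X_pow_sub_one_separable_iff.2 hnK).of_dvd hdX
  set dL := d.map (algebraMap K L) with hdL
  have hdL0 : dL ≠ 0 := (Polynomial.map_ne_zero_iff (algebraMap K L).injective).2 hd0
  have hcard : dL.roots.toFinset.card = d.natDegree := by
    rw [Multiset.toFinset_card_of_nodup (nodup_roots hsep.map),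
      ← IsAlgClosed.card_roots_map_eq_natDegree_of_injective d (algebraMap K L).injective]
  rw [← hcard, ← Finset.card_singleton (1 : L)]
  refine Finset.card_le_card fun z hz ↦ ?_
  rw [Finset.mem_singleton]
  by_contra hz1
  have hzd : dL.eval z = 0 := by simpa [hdL0] using hz
  have hzn : z ^ n = 1 := by
    have := eval_eq_zero_of_dvd_of_eval_eq_zero (Polynomial.map_dvd (algebraMap K L) hdX) hzd
    simpa [sub_eq_zero] using this
  have hzg : (g.map (algebraMap K L)).eval z = 0 :=
    eval_eq_zero_of_dvd_of_eval_eq_zero (Polynomial.map_dvd (algebraMap K L) hdg) hzd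
  have hpow : ∀ t : ℕ, (g.map (algebraMap K L)).eval (z ^ Nat.card F ^ t) = 0 := by
    intro t
    induction t with
    | zero => simpa using hzg
    | succ t ih =>
      rw [pow_succ, pow_mul]
      exact eval_pow_card_conjugatePoly_eq_zero (by rw [← pow_mul, mul_comm, pow_mul, hzn, one_pow]) ih
  have hprim : IsPrimitiveRoot z n := by
    have : Fact n.Prime := ⟨hn⟩
    rw [← orderOf_eq_prime hzn hz1]
    exact IsPrimitiveRoot.orderOf z
  have hall : ∀ j < n, (g.map (algebraMap K L)).eval (z ^ j) = 0 := by
    intro j hj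
    have : Fact n.Prime := ⟨hn⟩
    rcases Nat.eq_zero_or_pos j with rfl | hj0
    · rw [pow_zero, ← map_one (algebraMap K L), eval_map_algebraMap, aeval_algebraMap_apply]
      simp [hg, coe_aeval_eq_eval, eval_one_conjugatePoly, htr]
    · obtain ⟨u, hu, hgen⟩ := hq
      obtain ⟨t, ht⟩ := mem_powers_iff_mem_zpowers.2 (hgen (ZMod.unitOfCoprime j
        ((Nat.Prime.coprime_iff_not_dvd hn).2 (Nat.not_dvd_of_pos_of_lt hj0 hj)).symm))
      have ht' : Nat.card F ^ t ≡ j [MOD n] := by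
        rw [← ZMod.natCast_eq_natCast_iff]
        simpa [hu] using congrArg Units.val ht
      rw [← pow_eq_pow_of_modEq ht' hzn]
      exact hpow t
  have hgL0 : g.map (algebraMap K L) ≠ 0 :=
    (Polynomial.map_ne_zero_iff (algebraMap K L).injective).2 hg0
  have hsub : (Finset.range n).image (z ^ ·) ⊆ (g.map (algebraMap K L)).roots.toFinset := by
    intro w hw
    obtain ⟨j, hj, rfl⟩ := Finset.mem_image.1 hw
    simpa [hgL0] using hall j (Finset.mem_range.1 hj)
  have h1 := Finset.card_le_card hsub
  rw [Finset.card_image_of_injOn (by simpa using hprim.injOn_pow), Finset.card_range] at h1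
  have h2 := (Multiset.toFinset_card_le _).trans (card_roots' (g.map (algebraMap K L)))
  rw [natDegree_map] at h2
  exact absurd (natDegree_conjugatePoly_lt (F := F) α) (not_lt.2 (h1.trans h2))

/-- In a quadratic extension, a common root `x` of `X ^ 2 - 1` and `α * X + α ^ q` forces
`α ^ (2 * (q - 1)) = 1`, whereas `α` has order `q ^ 2 - 1`. -/
theorem not_hasPrimitiveOneNormal_of_finrank_eq_two [Finite F]
    (h2 : Module.finrank F K = 2) : ¬ HasPrimitiveOneNormal F K := by
  classical
  rintro ⟨α, ⟨u, rfl, hu⟩, -, hdeg⟩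
  have hg : conjugatePoly F (u : K) = C (u : K) * X + C ((u : K) ^ Nat.card F) := by
    simp [conjugatePoly, h2, Finset.sum_range_succ]
  rw [hg, h2] at hdeg
  set d := EuclideanDomain.gcd (X ^ 2 - 1 : K[X])
    (C (u : K) * X + C ((u : K) ^ Nat.card F)) with hd
  obtain ⟨x, hx⟩ : ∃ x, d.IsRoot x := exists_root_of_degree_eq_one
    ((degree_eq_iff_natDegree_eq_of_pos one_pos).2 (by convert hdeg))
  have hx1 : x ^ 2 = 1 := by
    have := eval_eq_zero_of_dvd_of_eval_eq_zero (EuclideanDomain.gcd_dvd_left _ _) hx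
    simpa [sub_eq_zero] using this
  have hx2 : (u : K) * x + (u : K) ^ Nat.card F = 0 := by
    have := eval_eq_zero_of_dvd_of_eval_eq_zero (EuclideanDomain.gcd_dvd_right _ _) hx
    simpa using this
  have hq : 1 < Nat.card F := Finite.one_lt_card
  obtain ⟨r, hr⟩ : ∃ r, Nat.card F = r + 2 := ⟨Nat.card F - 2, by omega⟩
  have hur : (u : K) ^ (2 * (r + 1)) = 1 := by
    have h3 : (u : K) ^ (r + 1) = -x := by
      have : (u : K) * ((u : K) ^ (r + 1) + x) = 0 := by
        rw [← hx2, hr]; ring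
      have := (mul_eq_zero.1 this).resolve_left u.ne_zero
      linear_combination this
    rw [mul_comm, pow_mul, h3, neg_sq, hx1]
  have hord : orderOf u = Nat.card K - 1 := by
    rw [orderOf_eq_card_of_forall_mem_zpowers hu, Nat.card_units]
  have hdvd := orderOf_dvd_of_pow_eq_one (x := u) (n := 2 * (r + 1)) (Units.ext (by simpa using hur))
  rw [hord, Module.natCard_eq_pow_finrank (K := F), h2, hr] at hdvd
  have := Nat.le_of_dvd (by omega) hdvd
  have h5 : (r + 2) ^ 2 = r * r + 4 * r + 4 := by ring
  omega

end Normality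

theorem corollary3p5 :
    (∀ (F K : Type*) [Field F] [Finite F] [Field K] [Finite K] [Algebra F K]
        (p q n : ℕ) [CharP F p],
        Nat.card F = q → Module.finrank F K = n → n.Prime → n ≠ p →
        IsPrimitiveElt (q : ZMod n) →
          (HasPrimitiveOneNormal F K → 3 ≤ n ∨ (n = 2 ∧ q = 3)) ∧
          (3 ≤ n → ¬(n = 3 ∧ q = 4) → HasPrimitiveOneNormal F K)) ∧
    (∀ (F K : Type*) [Field F] [Finite F] [Field K] [Finite K] [Algebra F K],
        Module.finrank F K = 2 → Odd (Nat.card F) → Nat.card F ≠ 3 →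
          ¬ HasPrimitiveOneNormal F K) ∧
    ¬ (∀ (F K : Type) [Field F] [Finite F] [Field K] [Finite K] [Algebra F K],
        2 ≤ Module.finrank F K → HasPrimitiveOneNormal F K) := by
  refine ⟨?_, fun F K _ _ _ _ _ h2 _ _ ↦ not_hasPrimitiveOneNormal_of_finrank_eq_two h2, fun h ↦ ?_⟩
  · rintro F K _ _ _ _ _ p q n _ rfl rfl hn hnp hq
    constructor
    · intro h
      have h2 : Module.finrank F K ≠ 2 := fun h2 ↦
        not_hasPrimitiveOneNormal_of_finrank_eq_two h2 h
      have := hn.two_le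
      omega
    · intro h3 _
      have := Fintype.ofFinite K
      obtain ⟨α, hα, hα0, htr⟩ := exists_isPrimitiveElt_trace_eq_zero hn h3 hq
      exact ⟨α, hα, isKNormal_one_of_trace_eq_zero hn hnp hq hα0 htr⟩
  · have : Fact (Nat.Prime 5) := ⟨Nat.prime_five⟩
    have h2 : Module.finrank (ZMod 5) (GaloisField 5 2) = 2 := GaloisField.finrank 5 two_ne_zero
    exact not_hasPrimitiveOneNormal_of_finrank_eq_two h2 (h (ZMod 5) (GaloisField 5 2) h2.ge)
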